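/- Let $p$ be a prime, let $X=\{x_1,\dots,x_p\}$, and let $T$ be the $p$-adic rooted tree, whose vertices are the words in the free monoid $X^*$, the descendants of a vertex $u$ being the words $ux$ with $x\in X$. Automorphisms of $T$ act on the right, so that $fg$ means "first $f$, then $g$". Let $\sigma=(x_1\,x_2\,\cdots\,x_p)$, and let $a,b\in\mathrm{Aut}(T)$ be defined by $a=(1,\dots,1,b)$ and $b=(1,\dots,1,a)\,\sigma$; that is, for every word $v\in X^*$, \[ (x_iv)^a=x_iv \text{ and } (x_iv)^b=x_{i+1}v \ \ (1\le i<p),\qquad (x_pv)^a=x_p\,v^b,\qquad (x_pv)^b=x_1\,v^a . \] Let $G=\langle a,b\rangle\le\mathrm{Aut}(T)$ be the $p$-Basilica group. Write $x^y=y^{-1}xy$ and $[x,y]=x^{-1}y^{-1}xy$. **Theorem.** The group $G$ has the presentation \[ G=\big\langle a,b \;\big|\; \xi^k\big(\theta^m([a,a^{b^l}])\big)=1 \text{ for all integers } k,m\ge 0 \text{ and } 1\le l\le p-1\big\rangle, \] where the generators $a,b$ of the presentation correspond to the automorphisms $a,b$, and $\xi,\theta$ are the endomorphisms of the free group on $\{a,b\}$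 given by \[ \xi:\ a\mapsto b^p,\quad b\mapsto a,\qquad\qquad \theta:\ a\mapsto a^{b^p+1}=a^{b^p}a,\quad b\mapsto b . \] This is an $L$-presentation: for a free group $F_S$ on a set $S$, subsets $Q,R\subseteq F_S$ and a set $\Phi$ of endomorphisms of $F_S$, an $L$-presentation is a presentation of the form $\langle S\mid Q\cup\bigcup_{\phi\in\Phi^*}\phi(R)\rangle$, where $\Phi^*$ is the monoid generated by $\Phi$; the set of relators above has this form with $S=\{a,b\}$, $Q=\varnothing$, $\Phi=\{\xi\}$ and $R=\{\theta^m([a,a^{b^l}])\mid m\ge 0,\ 1\le l\le p-1\}$. -/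

import Mathlib

namespace Basilica

/-- The `p`-adic rooted tree `T`: vertices are the finite words over an alphabet
`X = {x_1, …, x_p}` (here `Fin p`, with `x_i` represented by `i - 1`); the descendants of `u`
are the words `u x` with `x ∈ X`. -/
def tree (p : ℕ) : SimpleGraph (List (Fin p)) where
  Adj u v := (∃ x, v = u ++ [x]) ∨ (∃ x, u = v ++ [x])
  symm := ⟨fun _ _ h => h.symm⟩
  loopless := ⟨fun u h => by rcases h with ⟨x, h⟩ | ⟨x, h⟩ <;> simp at h⟩

/-- `Aut(T)`, the graph automorphisms of `T` under composition, acting on the right: the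
opposite group is taken so that a product `f * g` means "first `f`, then `g`". -/
abbrev AutT (p : ℕ) : Type := (tree p ≃g tree p)ᵐᵒᵖ

/-- The names of the two generators. -/
inductive Gen : Type
  | a : Gen
  | b : Gen

/-- The images of words under the generators, given by `ψ(a) = (1, …, 1, b)` and
`ψ(b) = (1, …, 1, a) σ` with `σ = (x_1 x_2 ⋯ x_p)`: the vertex `x v` is sent to
`(image of x under the label at the root) (image of v under the section at x)`. -/
def genFun (p : ℕ) : Gen → List (Fin p) → List (Fin p)
  | _, [] => []
  | .a, x :: v => x :: (if (x : ℕ) + 1 = p then genFun p .b v else v)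
  | .b, x :: v => finRotate p x :: (if (x : ℕ) + 1 = p then genFun p .a v else v)

/-- The inverses of the maps `genFun p g`. -/
def genInv (p : ℕ) : Gen → List (Fin p) → List (Fin p)
  | _, [] => []
  | .a, x :: v => x :: (if (x : ℕ) + 1 = p then genInv p .b v else v)
  | .b, x :: v => (finRotate p).symm x ::
      (if ((finRotate p).symm x : ℕ) + 1 = p then genInv p .a v else v)

theorem genInv_genFun (p : ℕ) (g : Gen) (w : List (Fin p)) :
    genInv p g (genFun p g w) = w := by
  induction w generalizing g with
  | nil => cases g <;> rfl
  | cons x v ih =>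
    cases g <;> by_cases h : (x : ℕ) + 1 = p <;>
      simp only [genFun, genInv, Equiv.symm_apply_apply, h, ih, if_true, if_false]

theorem genFun_genInv (p : ℕ) (g : Gen) (w : List (Fin p)) :
    genFun p g (genInv p g w) = w := by
  induction w generalizing g with
  | nil => cases g <;> rfl
  | cons x v ih =>
    cases g
    · by_cases h : (x : ℕ) + 1 = p <;> simp only [genFun, genInv, h, ih, if_true, if_false]
    · by_cases h : ((finRotate p).symm x : ℕ) + 1 = p <;>
        simp only [genFun, genInv, Equiv.apply_symm_apply, h, ih, if_true, if_false]

theorem genFun_append (p : ℕ) (g : Gen) (w : List (Fin p)) (x : Fin p) :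
    ∃ y, genFun p g (w ++ [x]) = genFun p g w ++ [y] := by
  induction w generalizing g with
  | nil => cases g <;> by_cases h : (x : ℕ) + 1 = p <;> simp [genFun]
  | cons z v ih =>
    cases g <;> by_cases h : (z : ℕ) + 1 = p <;> simp [genFun, h, ih]

theorem genInv_append (p : ℕ) (g : Gen) (w : List (Fin p)) (x : Fin p) :
    ∃ y, genInv p g (w ++ [x]) = genInv p g w ++ [y] := by
  induction w generalizing g with
  | nil => cases g <;> simp [genInv]
  | cons z v ih =>
    cases g
    · by_cases h : (z : ℕ) + 1 = p <;>
        simp [genInv, h, ih, -finRotate_symm_apply]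
    · by_cases h : ((finRotate p).symm z : ℕ) + 1 = p <;>
        simp [genInv, h, ih, -finRotate_symm_apply]

/-- The graph automorphism of `T` given by a generator. -/
def genIso (p : ℕ) (g : Gen) : tree p ≃g tree p where
  toFun := genFun p g
  invFun := genInv p g
  left_inv := genInv_genFun p g
  right_inv := genFun_genInv p g
  map_rel_iff' := by
    intro u v
    change (tree p).Adj (genFun p g u) (genFun p g v) ↔ (tree p).Adj u v
    constructor
    · rintro (⟨x, h⟩ | ⟨x, h⟩)
      · obtain ⟨y, hy⟩ := genInv_append p g (genFun p g u) x
        rw [← h, genInv_genFun, genInv_genFun] at hy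
        exact Or.inl ⟨y, hy⟩
      · obtain ⟨y, hy⟩ := genInv_append p g (genFun p g v) x
        rw [← h, genInv_genFun, genInv_genFun] at hy
        exact Or.inr ⟨y, hy⟩
    · rintro (⟨x, rfl⟩ | ⟨x, rfl⟩)
      · exact Or.inl (genFun_append p g u x)
      · exact Or.inr (genFun_append p g v x)

/-- The automorphisms `a` and `b` of `T`, as elements of `Aut(T)`. -/
def gen (p : ℕ) (g : Gen) : AutT p := MulOpposite.op (genIso p g)

/-- The `p`-Basilica group `G = ⟨a, b⟩ ≤ Aut(T)`. -/
def group (p : ℕ) : Subgroup (AutT p) := Subgroup.closure {gen p .a, gen p .b}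

/-- The conjugate `x^y = y⁻¹ x y`. -/
def conj {H : Type*} [Group H] (x y : H) : H := y⁻¹ * x * y

/-- The commutator `[x, y] = x⁻¹ y⁻¹ x y`. -/
def comm {H : Type*} [Group H] (x y : H) : H := x⁻¹ * y⁻¹ * x * y

/-- The free generator `a` of the free group on `{a, b}`. -/
def fa : FreeGroup Gen := FreeGroup.of .a

/-- The free generator `b` of the free group on `{a, b}`. -/
def fb : FreeGroup Gen := FreeGroup.of .b

/-- The endomorphism `ξ : a ↦ b^p, b ↦ a` of the free group. -/
def xi (p : ℕ) : Monoid.End (FreeGroup Gen) :=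
  FreeGroup.lift fun
    | .a => fb ^ p
    | .b => fa

/-- The endomorphism `θ : a ↦ a^{b^p + 1} = a^{b^p} a, b ↦ b` of the free group. -/
def theta (p : ℕ) : Monoid.End (FreeGroup Gen) :=
  FreeGroup.lift fun
    | .a => conj fa (fb ^ p) * fa
    | .b => fb

/-- The relators `ξ^k(θ^m([a, a^{b^l}]))` for `k, m ≥ 0` and `1 ≤ l ≤ p - 1`. -/
def relators (p : ℕ) : Set (FreeGroup Gen) :=
  {r | ∃ k m l : ℕ, 1 ≤ l ∧ l < p ∧ r = (xi p ^ k) ((theta p ^ m) (comm fa (conj fa (fb ^ l))))}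

/-- The relators `Q ∪ ⋃_{φ ∈ Φ^*} φ(R)` of an `L`-presentation with data `S, Q, R, Φ`, where
`Φ^*` is the monoid generated by the set `Φ` of endomorphisms of the free group on `S`. -/
def lRelators {S : Type*} (Q R : Set (FreeGroup S)) (Φ : Set (Monoid.End (FreeGroup S))) :
    Set (FreeGroup S) :=
  Q ∪ ⋃ φ ∈ Submonoid.closure Φ, φ '' R

end Basilica

namespace Basilica

open Equiv MulOpposite

/-! Let N be the normal closure of the relators in the free group F. The claim is that N is the
kernel of the action of F on the tree.

The relators act trivially: θ^m(a) is supported over the last vertex of the first level and its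
conjugate by b^l over another vertex, so the two commute. Moreover ξ(w) has section w at the last
vertex and elsewhere the image of w under b ↦ 1, which is trivial for a commutator
(`toAut_relator`).

Conversely, the θ-relators make a^{b^i} and a^{b^j} commute modulo N whenever p does not divide j -
i (`zconj_commute`). Hence modulo N the normal closure of a is a product of p commuting factors, one
per vertex, and ξ followed by conjugation by a power of b lifts sections back into each factor.
Since ξ(N) ⊆ N, a word with trivial root permutation and all sections in N lies in N
(`mem_normalClosure_of_sec`). Induction on length finishes: sections are strictly shorter unless the
word equals some b^{-d} a^i b^e with d, e ≤ 1 (`exists_section_word`), and such an element acts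
trivially only if it is 1 (`eq_one_of_toAut_eq_one`). -/

/-- The free group on `{a, b}`. -/
abbrev F : Type := FreeGroup Gen

/-! ### Wreath recursion on the free group -/

/-- The right action of permutations of `Fin p` on the base group of the wreath product. -/
def permArrow (p : ℕ) : (Perm (Fin p))ᵐᵒᵖ →* MulAut (Fin p → F) where
  toFun q :=
    { toFun := fun n x => n (q.unop x)
      invFun := fun n x => n (q.unop.symm x)
      left_inv := fun n => by ext x; simp
      right_inv := fun n => by ext x; simp
      map_mul' := fun _ _ => rfl }
  map_one' := rfl
  map_mul' _ _ := rfl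

/-- The wreath recursion `ψ(a) = (1, …, 1, b)`, `ψ(b) = (1, …, 1, a) σ` on the free group. -/
def decomp (p : ℕ) : F →* (Fin p → F) ⋊[permArrow p] (Perm (Fin p))ᵐᵒᵖ :=
  FreeGroup.lift fun
    | .a => ⟨fun x => if (x : ℕ) + 1 = p then fb else 1, 1⟩
    | .b => ⟨fun x => if (x : ℕ) + 1 = p then fa else 1, op (finRotate p)⟩

/-- The permutation of the first level induced by a word. -/
def root (p : ℕ) (w : F) : Perm (Fin p) := (decomp p w).right.unop

/-- The section of a word at a vertex of the first level. -/
def sec (p : ℕ) (w : F) (x : Fin p) : F := (decomp p w).left x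

variable {p : ℕ}

theorem root_mul (w w' : F) : root p (w * w') = root p w' * root p w := by
  simp [root]

theorem sec_mul (w w' : F) (x : Fin p) :
    sec p (w * w') x = sec p w x * sec p w' (root p w x) := by
  rw [sec, map_mul, SemidirectProduct.mul_left]; rfl

@[simp] theorem root_one : root p 1 = 1 := by simp [root]

@[simp] theorem sec_one (x : Fin p) : sec p 1 x = 1 := by simp [sec]

theorem root_inv (w : F) : root p w⁻¹ = (root p w).symm := by rw [root, map_inv]; rfl

theorem root_mul_symm (w : F) : root p w * (root p w).symm = 1 := mul_inv_cancel (root p w)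

@[simp] theorem perm_one_symm {X : Type*} : Equiv.symm (1 : Perm X) = 1 := rfl

theorem sec_inv (w : F) (x : Fin p) : sec p w⁻¹ x = (sec p w ((root p w).symm x))⁻¹ := by
  have h := sec_mul (p := p) w w⁻¹ ((root p w).symm x)
  rw [mul_inv_cancel, sec_one, Equiv.apply_symm_apply] at h
  exact (inv_eq_of_mul_eq_one_right h.symm).symm

@[simp] theorem root_fa : root p fa = 1 := by simp [root, decomp, fa]

@[simp] theorem root_fb : root p fb = finRotate p := by simp [root, decomp, fb]

theorem sec_fa (x : Fin p) : sec p fa x = if (x : ℕ) + 1 = p then fb else 1 := by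
  simp [sec, decomp, fa]

theorem sec_fb (x : Fin p) : sec p fb x = if (x : ℕ) + 1 = p then fa else 1 := by
  simp [sec, decomp, fb]

theorem free_induction {P : F → Prop} (one : P 1) (of_a : P fa) (of_b : P fb)
    (inv : ∀ w, P w → P w⁻¹) (mul : ∀ w w', P w → P w' → P (w * w')) (w : F) : P w :=
  FreeGroup.induction_on w one (fun g => by cases g; exacts [of_a, of_b])
    (fun g h => inv _ h) (fun _ _ => mul _ _)

/-! ### The action on the tree -/

/-- The homomorphism from the free group to `Aut(T)`. -/
def toAut (p : ℕ) : F →* AutT p := FreeGroup.lift (gen p)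

theorem toAut_mul_apply (w w' : F) (v : List (Fin p)) :
    (toAut p (w * w')).unop v = (toAut p w').unop ((toAut p w).unop v) := by
  rw [map_mul]; rfl

theorem toAut_one_apply (v : List (Fin p)) : (toAut p 1).unop v = v := by
  rw [map_one]; rfl

theorem toAut_fa_apply (v : List (Fin p)) : (toAut p fa).unop v = genFun p .a v := by
  simp only [toAut, fa, FreeGroup.lift_apply_of]; rfl

theorem toAut_fb_apply (v : List (Fin p)) : (toAut p fb).unop v = genFun p .b v := by
  simp only [toAut, fb, FreeGroup.lift_apply_of]; rfl

theorem toAut_apply_inv_apply (w : F) (v : List (Fin p)) :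
    (toAut p w⁻¹).unop ((toAut p w).unop v) = v := by
  rw [← toAut_mul_apply, mul_inv_cancel, toAut_one_apply]

theorem toAut_apply_nil (w : F) : (toAut p w).unop [] = [] := by
  induction w using free_induction with
  | one => exact toAut_one_apply _
  | of_a => exact (toAut_fa_apply _).trans rfl
  | of_b => exact (toAut_fb_apply _).trans rfl
  | inv w ih =>
    have h := toAut_apply_inv_apply (p := p) w []
    rwa [ih] at h
  | mul w w' h h' => rw [toAut_mul_apply, h, h']

theorem toAut_apply_cons (w : F) (x : Fin p) (v : List (Fin p)) :
    (toAut p w).unop (x :: v) = root p w x :: (toAut p (sec p w x)).unop v := by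
  induction w using free_induction generalizing x v with
  | one => simp
  | of_a =>
    rw [toAut_fa_apply, sec_fa, root_fa]
    split_ifs with h
    · simp [genFun, h, toAut_fb_apply]
    · simp [genFun, h]
  | of_b =>
    rw [toAut_fb_apply, sec_fb, root_fb]
    split_ifs with h
    · simp [genFun, h, toAut_fa_apply]
    · simp [genFun, h]
  | inv w ih =>
    have h := toAut_apply_inv_apply (p := p) w
      (((root p w).symm x) :: (toAut p (sec p w⁻¹ x)).unop v)
    rw [ih, sec_inv, ← toAut_mul_apply, inv_mul_cancel, toAut_one_apply,
      Equiv.apply_symm_apply] at h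
    rw [h, sec_inv, root_inv]
  | mul w w' h h' =>
    rw [toAut_mul_apply, h, h', sec_mul, root_mul, toAut_mul_apply]; rfl

theorem toAut_eq_one_iff (w : F) :
    toAut p w = 1 ↔ root p w = 1 ∧ ∀ x, toAut p (sec p w x) = 1 := by
  have ext_iff' : ∀ u : F, toAut p u = 1 ↔ ∀ v, (toAut p u).unop v = v := by
    intro u
    constructor
    · intro h v; rw [h]; rfl
    · intro h
      exact MulOpposite.unop_injective (RelIso.ext h)
  constructor
  · intro h
    rw [ext_iff'] at h
    constructor
    · ext x
      have := h [x]
      rw [toAut_apply_cons] at this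
      simpa using congrArg (fun y : Fin p => (y : ℕ)) (List.cons.inj this).1
    · intro x
      rw [ext_iff']
      intro v
      have := h (x :: v)
      rw [toAut_apply_cons] at this
      exact (List.cons.inj this).2
  · rintro ⟨h, h'⟩
    rw [ext_iff']
    rintro (_ | ⟨x, v⟩)
    · exact toAut_apply_nil w
    · rw [toAut_apply_cons, h, h']; rfl

/-! ### Sections of powers of b -/

theorem finRotate_pow_val (k : ℕ) (x : Fin p) :
    (((finRotate p) ^ k) x : ℕ) = (x + k) % p := by
  rcases p with _ | n
  · exact x.elim0
  induction k with
  | zero => simp [Nat.mod_eq_of_lt x.2]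
  | succ k ih =>
    rw [pow_succ', Perm.mul_apply, finRotate_apply, Fin.val_add, ih, Fin.val_one']
    simp [Nat.add_assoc]

theorem root_pow (w : F) (k : ℕ) : root p (w ^ k) = root p w ^ k := by
  induction k with
  | zero => simp
  | succ k ih => rw [pow_succ, root_mul, ih, pow_succ']

/-- In at most p steps of the rotation the path from x leaves the last vertex at most once, and each
such departure contributes one a. -/
theorem sec_fb_pow {k : ℕ} (hk : k ≤ p) (x : Fin p) :
    sec p (fb ^ k) x = if p ≤ x + k then fa else 1 := by
  induction k with
  | zero => have := x.2; simp
  | succ k ih =>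
    have hx := x.2
    rw [pow_succ, sec_mul, ih (by omega), sec_fb, root_pow, root_fb, finRotate_pow_val]
    by_cases h1 : p ≤ x + k
    · have : (x + k) % p = x + k - p := by
        rw [Nat.mod_eq_sub_mod h1, Nat.mod_eq_of_lt (by omega)]
      rw [this, if_pos h1, if_neg (by omega), if_pos (by omega), mul_one]
    · rw [Nat.mod_eq_of_lt (by omega), if_neg h1, one_mul]
      congr 1
      simp only [eq_iff_iff]; omega

theorem decomp_ext {w w' : F} (h : root p w = root p w')
    (h' : ∀ x, sec p w x = sec p w' x) : decomp p w = decomp p w' :=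
  SemidirectProduct.ext (funext h') (MulOpposite.unop_injective h)

theorem finRotate_pow_self : (finRotate p) ^ p = 1 := by
  ext x
  simp [finRotate_pow_val, Nat.mod_eq_of_lt x.2]

theorem root_fb_pow_self : root p (fb ^ p) = 1 := by
  rw [root_pow, root_fb, finRotate_pow_self]

theorem sec_fb_pow_self (x : Fin p) : sec p (fb ^ p) x = fa := by
  rw [sec_fb_pow le_rfl, if_pos (by omega)]

/-! ### The endomorphisms ξ and θ; the relators act trivially -/

/-- The retraction of the free group onto `⟨a⟩` killing `b`. -/
def killB : F →* F :=
  FreeGroup.lift fun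
    | .a => fa
    | .b => 1

theorem xi_fa : xi p fa = fb ^ p := by
  unfold xi fa; exact FreeGroup.lift_apply_of

theorem xi_fb : xi p fb = fa := by
  unfold xi fb; exact FreeGroup.lift_apply_of

@[simp] theorem killB_fa : killB fa = fa := by
  unfold killB; exact FreeGroup.lift_apply_of

@[simp] theorem killB_fb : killB fb = 1 := by
  unfold killB; exact FreeGroup.lift_apply_of

/-- On generators: b^p has section a at every vertex, while a has section b at the last vertex only.
-/
theorem root_xi_and_sec_xi (w : F) : root p (xi p w) = 1 ∧
    ∀ x : Fin p, sec p (xi p w) x = if (x : ℕ) + 1 = p then w else killB w := by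
  induction w using free_induction with
  | one => simp
  | of_a => simp [xi_fa, root_fb_pow_self, sec_fb_pow_self]
  | of_b => simp [xi_fb, sec_fa]
  | inv w ih =>
    rw [map_inv]
    refine ⟨by rw [root_inv, ih.1]; rfl, fun x => ?_⟩
    rw [sec_inv, ih.1, ih.2]
    split_ifs with h1 h2 h2 <;> first | rfl | exact absurd h1 h2 | exact absurd h2 h1 | simp
  | mul w w' h h' =>
    rw [map_mul]
    refine ⟨by rw [root_mul, h.1, h'.1]; rfl, fun x => ?_⟩
    rw [sec_mul, h.1, h.2, h'.2, Perm.one_apply]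
    split_ifs <;> simp

theorem root_xi (w : F) : root p (xi p w) = 1 :=
  (root_xi_and_sec_xi w).1

theorem sec_xi (w : F) (x : Fin p) :
    sec p (xi p w) x = if (x : ℕ) + 1 = p then w else killB w :=
  (root_xi_and_sec_xi w).2 x

/-- The image of `killB` is cyclic, hence abelian. -/
theorem killB_comm (u v : F) : killB (comm u v) = 1 := by
  have h : ∀ w, killB w ∈ Subgroup.zpowers fa := by
    intro w
    induction w using free_induction with
    | one => simp
    | of_a => simp
    | of_b => simp
    | inv w h => rw [map_inv]; exact inv_mem h
    | mul u v h h' => rw [map_mul]; exact mul_mem h h'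
  obtain ⟨i, hi⟩ := h u
  obtain ⟨j, hj⟩ := h v
  simp only [comm, map_mul, map_inv, ← hi, ← hj]
  group

theorem End_map_comm (φ : Monoid.End F) (u v : F) : φ (comm u v) = comm (φ u) (φ v) := by
  simp [comm]

theorem End_pow_succ_apply (φ : Monoid.End F) (n : ℕ) (w : F) :
    (φ ^ (n + 1)) w = (φ ^ n) (φ w) := by
  rw [pow_succ]; rfl

theorem End_pow_succ_apply' (φ : Monoid.End F) (n : ℕ) (w : F) :
    (φ ^ (n + 1)) w = φ ((φ ^ n) w) := by
  rw [pow_succ']; rfl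

theorem theta_fa : theta p fa = conj fa (fb ^ p) * fa := by
  unfold theta; exact FreeGroup.lift_apply_of

theorem theta_fb : theta p fb = fb := by
  unfold theta; exact FreeGroup.lift_apply_of

theorem theta_pow_fb (m : ℕ) : (theta p ^ m) fb = fb := by
  induction m with
  | zero => rfl
  | succ m ih => rw [End_pow_succ_apply, theta_fb, ih]

theorem theta_pow_succ_fa (m : ℕ) :
    (theta p ^ (m + 1)) fa = conj ((theta p ^ m) fa) (fb ^ p) * (theta p ^ m) fa := by
  rw [End_pow_succ_apply, theta_fa]
  simp only [conj, map_mul, map_inv, map_pow, theta_pow_fb]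

theorem theta_pow_relator (m l : ℕ) :
    (theta p ^ m) (comm fa (conj fa (fb ^ l))) =
      comm ((theta p ^ m) fa) (conj ((theta p ^ m) fa) (fb ^ l)) := by
  simp only [End_map_comm, conj, map_mul, map_inv, map_pow, theta_pow_fb]

/-- Conjugation by b^p preserves the support because b^p fixes the first level. -/
theorem theta_pow_fa_support (m : ℕ) : root p ((theta p ^ m) fa) = 1 ∧
    ∀ x : Fin p, (x : ℕ) + 1 ≠ p → sec p ((theta p ^ m) fa) x = 1 := by
  induction m with
  | zero => exact ⟨root_fa, fun x hx => (sec_fa x).trans (if_neg hx)⟩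
  | succ m ih =>
    rw [theta_pow_succ_fa]
    generalize (theta p ^ m) fa = u at ih
    refine ⟨by simp [conj, root_mul, root_inv, ih.1, root_fb_pow_self], fun x hx => ?_⟩
    simp [conj, sec_mul, sec_inv, root_mul, root_inv, ih.1, root_fb_pow_self, ih.2 x hx]

/-- Elements with disjoint supports on the first level commute, already in the wreath product over
the free group. -/
theorem decomp_theta_relator {m l : ℕ} (hl : 1 ≤ l) (hlp : l < p) :
    decomp p ((theta p ^ m) (comm fa (conj fa (fb ^ l)))) = 1 := by
  rw [theta_pow_relator]
  set u := (theta p ^ m) fa with hu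
  obtain ⟨h1, h2⟩ := theta_pow_fa_support (p := p) m
  rw [← hu] at h1 h2
  have r2 : root p (conj u (fb ^ l)) = 1 := by
    simp [conj, root_mul, root_inv, h1, root_mul_symm]
  have s2 : ∀ x : Fin p, (x : ℕ) + 1 = p → sec p (conj u (fb ^ l)) x = 1 := by
    intro x hx
    have : sec p u ((finRotate p ^ l).symm x) = 1 := by
      apply h2
      intro h
      have := finRotate_pow_val l ((finRotate p ^ l).symm x)
      rw [Equiv.apply_symm_apply] at this
      -- If the preimage were also the last vertex p - 1, rotating it by l would give l - 1 < p - 1.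
      have e : (((finRotate p ^ l).symm x : Fin p) : ℕ) + l = (l - 1) + p := by omega
      rw [e, Nat.add_mod_right, Nat.mod_eq_of_lt (by omega)] at this
      omega
    simp [conj, sec_mul, sec_inv, root_mul, root_inv, h1, root_pow, this, -finRotate_symm_apply]
  have : Commute (decomp p u) (decomp p (conj u (fb ^ l))) := by
    rw [commute_iff_eq, ← map_mul, ← map_mul]
    refine decomp_ext (by simp [root_mul, h1, r2]) fun x => ?_
    rw [sec_mul, sec_mul, h1, r2, Perm.one_apply]
    by_cases hx : (x : ℕ) + 1 = p
    · rw [s2 x hx, one_mul, mul_one]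
    · rw [h2 x hx, one_mul, mul_one]
  simp only [comm, map_mul, map_inv]
  rw [← mul_inv_rev, mul_assoc, this.eq, inv_mul_cancel]

theorem killB_relator {r : F} (hr : r ∈ relators p) : killB r = 1 := by
  obtain ⟨k, m, l, -, -, rfl⟩ := hr
  rw [End_map_comm, End_map_comm, killB_comm]

theorem toAut_relator {r : F} (hr : r ∈ relators p) : toAut p r = 1 := by
  obtain ⟨k, m, l, hl, hlp, rfl⟩ := hr
  induction k with
  | zero =>
    have h := decomp_theta_relator (m := m) hl hlp
    rw [toAut_eq_one_iff]
    refine ⟨by rw [root]; erw [h]; rfl, fun x => ?_⟩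
    have : sec p ((xi p ^ 0) ((theta p ^ m) (comm fa (conj fa (fb ^ l))))) x = 1 := by
      rw [sec]; erw [h]; rfl
    rw [this, map_one]
  | succ k ih =>
    rw [End_pow_succ_apply', toAut_eq_one_iff]
    refine ⟨root_xi _, fun x => ?_⟩
    rw [sec_xi]
    split_ifs
    · exact ih
    · rw [End_map_comm, End_map_comm, killB_comm, map_one]

/-! ### From the θ-relators to commuting conjugates -/

section Commutation

variable {H : Type*} [Group H]

theorem commute_of_mem_closure {S : Set H} {g x : H} (h : ∀ s ∈ S, Commute g s)
    (hx : x ∈ Subgroup.closure S) : Commute g x := by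
  induction hx using Subgroup.closure_induction with
  | mem s hs => exact h s hs
  | one => exact Commute.one_right g
  | mul x y _ _ hx hy => exact hx.mul_right hy
  | inv x _ hx => exact hx.inv_right

theorem commute_of_mem_closure_closure {S T : Set H} {g x : H}
    (h : ∀ t ∈ T, ∀ s ∈ S, Commute t s) (hg : g ∈ Subgroup.closure T)
    (hx : x ∈ Subgroup.closure S) : Commute g x :=
  commute_of_mem_closure (fun s hs =>
    (commute_of_mem_closure (fun t ht => (h t ht s hs).symm) hg).symm) hx

/-- The conjugate `x^{y^j}` for an integer `j`. -/
def zconj (x y : H) (j : ℤ) : H := conj x (y ^ j)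

theorem conj_zconj (x y : H) (j k : ℤ) : conj (zconj x y j) (y ^ k) = zconj x y (j + k) := by
  simp only [zconj, conj, zpow_add]; group

theorem conj_mul (x y g : H) : conj (x * y) g = conj x g * conj y g := by
  simp only [conj]; group

theorem commute_conj {x y : H} (h : Commute x y) (g : H) :
    Commute (conj x g) (conj y g) := by
  rw [commute_iff_eq, ← conj_mul, ← conj_mul, h.eq]

theorem zconj_commute_iff (x y : H) (i j : ℤ) :
    Commute (zconj x y i) (zconj x y j) ↔ Commute (zconj x y 0) (zconj x y (j - i)) := by
  constructor
  · intro h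
    have := commute_conj h (y ^ (-i))
    rwa [conj_zconj, conj_zconj, add_neg_cancel, ← sub_eq_add_neg] at this
  · intro h
    have := commute_conj h (y ^ i)
    rwa [conj_zconj, conj_zconj, zero_add, sub_add_cancel] at this

/-- The conjugates `x^{y^{ip + l}}` with `r ≤ i < s`. -/
def zconjSet (p : ℕ) (x y : H) (l r s : ℤ) : Set H :=
  {g | ∃ i : ℤ, r ≤ i ∧ i < s ∧ g = zconj x y (i * p + l)}

theorem zconj_mem_closure {p : ℕ} {x y : H} {l r s i j : ℤ} (h1 : r ≤ i) (h2 : i < s)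
    (hj : j = i * p + l) : zconj x y j ∈ Subgroup.closure (zconjSet p x y l r s) :=
  Subgroup.subset_closure ⟨i, h1, h2, by rw [hj]⟩

theorem conj_mem_closure_zconjSet {p : ℕ} {x y g : H} {l r s r' s' : ℤ} (k t : ℤ)
    (hr : r' ≤ r + t) (hs : s + t ≤ s')
    (hg : g ∈ Subgroup.closure (zconjSet p x y l r s)) :
    conj g (y ^ (t * p + k)) ∈ Subgroup.closure (zconjSet p x y (l + k) r' s') := by
  induction hg using Subgroup.closure_induction with
  | mem g hg =>
    obtain ⟨i, h1, h2, rfl⟩ := hg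
    rw [conj_zconj]
    exact zconj_mem_closure (i := i + t) (by omega) (by omega) (by ring)
  | one => simp [conj]
  | mul g h _ _ hg hh => rw [conj_mul]; exact mul_mem hg hh
  | inv g _ hg =>
    have : conj g⁻¹ (y ^ (t * p + k)) = (conj g (y ^ (t * p + k)))⁻¹ := by
      simp only [conj]; group
    rw [this]; exact inv_mem hg

theorem closure_zconjSet_mono {p : ℕ} {x y : H} {l r s r' s' : ℤ} (hr : r' ≤ r) (hs : s ≤ s') :
    Subgroup.closure (zconjSet p x y l r s) ≤ Subgroup.closure (zconjSet p x y l r' s') := by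
  apply Subgroup.closure_mono
  rintro _ ⟨i, h1, h2, rfl⟩
  exact ⟨i, by omega, by omega, rfl⟩

theorem conj_pow_mem_closure_zconjSet {p : ℕ} {x y g : H} {l r s : ℤ}
    (hg : g ∈ Subgroup.closure (zconjSet p x y l r s)) :
    conj g (y ^ p) ∈ Subgroup.closure (zconjSet p x y l (r + 1) (s + 1)) := by
  have h := conj_mem_closure_zconjSet 0 1 (le_refl (r + 1)) (le_refl (s + 1)) hg
  rwa [one_mul, add_zero, add_zero, zpow_natCast] at h

/-- The bounds on the index ranges keep every exponent difference, taken positive, below mp; since 0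
< l < p it is never a multiple of p. -/
theorem zconjSet_commute {p : ℕ} {x y : H} {m l r s r' s' : ℤ} (hl : 0 < l) (hlp : l < p)
    (hcomm : ∀ j : ℤ, 0 < j → j < m * p → ¬ (p : ℤ) ∣ j → Commute (zconj x y 0) (zconj x y j))
    (h1 : s' ≤ m + r) (h2 : s ≤ m + r' + 1) {g h : H}
    (hg : g ∈ Subgroup.closure (zconjSet p x y 0 r s))
    (hh : h ∈ Subgroup.closure (zconjSet p x y l r' s')) : Commute g h := by
  refine commute_of_mem_closure_closure ?_ hg hh
  rintro _ ⟨i, hi, hi', rfl⟩ _ ⟨j, hj, hj', rfl⟩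
  have hndvd : ¬ (p : ℤ) ∣ l := fun h => by
    have := Int.le_of_dvd hl h; omega
  rw [add_zero]
  rcases le_or_gt i j with hij | hij
  · rw [zconj_commute_iff]
    have e : j * (p : ℤ) + l - i * p = (j - i) * p + l := by ring
    rw [e]
    have : (j - i + 1) * (p : ℤ) ≤ m * p := by
      apply mul_le_mul_of_nonneg_right _ (by omega); omega
    have h0 : 0 ≤ (j - i) * (p : ℤ) := mul_nonneg (by omega) (by omega)
    refine hcomm _ (by omega) (by linarith) fun h => hndvd ?_
    exact (Int.dvd_add_right (Dvd.intro_left _ rfl)).1 h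
  · refine Commute.symm ?_
    rw [zconj_commute_iff]
    have e : i * (p : ℤ) - (j * p + l) = (i - j) * p - l := by ring
    rw [e]
    have : (i - j) * (p : ℤ) ≤ m * p := by
      apply mul_le_mul_of_nonneg_right _ (by omega); omega
    have h0 : 1 * (p : ℤ) ≤ (i - j) * p := mul_le_mul_of_nonneg_right (by omega) (by omega)
    refine hcomm _ (by omega) (by linarith) fun h => hndvd ?_
    exact (Int.dvd_iff_dvd_of_dvd_sub h).1 (Dvd.intro_left _ rfl) |> fun h => by simpa using h

/-- The image of `θ^m(a)` under the homomorphism with `a ↦ x`, `b ↦ y`. -/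
def thetaSeq (p : ℕ) (x y : H) : ℕ → H
  | 0 => x
  | m + 1 => conj (thetaSeq p x y m) (y ^ p) * thetaSeq p x y m

/-- θ^m(a) is a product of conjugates a^{b^{ip}} with 0 ≤ i ≤ m, in which i = m occurs only as the
first factor and i = 0 only as the last. Isolating these extremes lets the m-th relator yield
exactly one new commutation. -/
theorem thetaSeq_mem (p : ℕ) (x y : H) (m : ℕ) :
    (∃ α ∈ Subgroup.closure (zconjSet p x y 0 1 (m + 1)), thetaSeq p x y m = α * zconj x y 0) ∧
    (∃ β ∈ Subgroup.closure (zconjSet p x y 0 0 m), thetaSeq p x y m = zconj x y (m * p) * β) := by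
  induction m with
  | zero =>
    exact ⟨⟨1, one_mem _, by simp [thetaSeq, zconj, conj]⟩,
      ⟨1, one_mem _, by simp [thetaSeq, zconj, conj]⟩⟩
  | succ m ih =>
    obtain ⟨⟨α, hα, eα⟩, ⟨β, hβ, eβ⟩⟩ := ih
    have hmem : thetaSeq p x y m ∈ Subgroup.closure (zconjSet p x y 0 0 (m + 1)) := by
      rw [eβ]
      exact mul_mem (zconj_mem_closure (i := m) (by omega) (by omega) (by ring))
        (closure_zconjSet_mono le_rfl (by omega) hβ)
    push_cast
    refine ⟨⟨conj (thetaSeq p x y m) (y ^ p) * α, mul_mem ?_ ?_, ?_⟩,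
      ⟨conj β (y ^ p) * thetaSeq p x y m, mul_mem ?_ hmem, ?_⟩⟩
    · simpa using conj_pow_mem_closure_zconjSet hmem
    · exact closure_zconjSet_mono le_rfl (by omega) hα
    · rw [mul_assoc, ← eα]; rfl
    · exact closure_zconjSet_mono (by omega) le_rfl (conj_pow_mem_closure_zconjSet hβ)
    · have h1 : conj (thetaSeq p x y m) (y ^ p) =
          zconj x y ((m + 1) * p) * conj β (y ^ p) := by
        rw [eβ, conj_mul, ← zpow_natCast, conj_zconj, add_one_mul]
      rw [← mul_assoc, ← h1]; rfl

/-- Induction on m gives commutation for all admissible differences below mp. In the m-th relator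
with shift l, every pair of factors has a smaller difference except the extreme pair, at difference
mp + l. -/
theorem zconj_commute {p : ℕ} (hp : 0 < p) {x y : H}
    (h : ∀ m l : ℕ, 1 ≤ l → l < p →
      Commute (thetaSeq p x y m) (conj (thetaSeq p x y m) (y ^ l)))
    {i j : ℤ} (hij : ¬ (p : ℤ) ∣ j - i) : Commute (zconj x y i) (zconj x y j) := by
  have main : ∀ m : ℕ, ∀ j : ℤ, 0 < j → j < m * p → ¬ (p : ℤ) ∣ j →
      Commute (zconj x y 0) (zconj x y j) := by
    intro m
    induction m with
    | zero => intro j h1 h2; simp at h2; omega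
    | succ m ih =>
      intro j h1 h2 h3
      by_cases hj : j < m * p
      · exact ih j h1 hj h3
      obtain ⟨l, rfl⟩ : ∃ l, j = m * p + l := ⟨j - m * p, by ring⟩
      have hl0 : l ≠ 0 := by rintro rfl; exact h3 (by simp)
      have hl : 0 < l := by omega
      have hlp : l < p := by
        push_cast at h2
        rw [add_mul, one_mul] at h2
        omega
      obtain ⟨⟨α, hα, eα⟩, ⟨β, hβ, eβ⟩⟩ := thetaSeq_mem p x y m
      have hβ' := conj_mem_closure_zconjSet (r' := 0) (s' := m) l 0 (by omega) (by omega) hβ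
      rw [zero_mul, zero_add] at hβ'
      have hr := h m l.toNat (by omega) (by omega)
      have el : y ^ l.toNat = y ^ l := by
        rw [← zpow_natCast, Int.toNat_of_nonneg hl.le]
      rw [el] at hr
      -- Splitting the first copy at its right end and the second at its left end leaves α and the
      -- shifted β to be cancelled, as they commute with what they must pass.
      nth_rw 2 [eβ] at hr
      rw [eα, conj_mul, conj_zconj] at hr
      have hz : zconj x y (m * p + l) ∈ Subgroup.closure (zconjSet p x y l m (m + 1)) :=
        zconj_mem_closure (i := m) (by omega) (by omega) (by ring)
      have h0 : zconj x y 0 ∈ Subgroup.closure (zconjSet p x y 0 0 1) :=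
        zconj_mem_closure (i := 0) (by omega) (by omega) (by ring)
      have c1 : Commute α (zconj x y (m * p + l)) :=
        zconjSet_commute hl hlp ih (by omega) (by omega) hα hz
      have c2 : Commute α (conj β (y ^ l)) :=
        zconjSet_commute hl hlp ih (by omega) (by omega) hα hβ'
      have c3 : Commute (zconj x y 0) (conj β (y ^ l)) :=
        zconjSet_commute hl hlp ih (by omega) (by omega) h0 hβ'
      have c4 : Commute (zconj x y 0) (zconj x y (m * p + l) * conj β (y ^ l)) := by
        have := (c1.mul_right c2).inv_left.mul_left hr
        rwa [inv_mul_cancel_left] at this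
      have := c4.mul_right c3.inv_right
      rwa [mul_inv_cancel_right] at this
  rw [zconj_commute_iff]
  rcases lt_trichotomy (j - i) 0 with hlt | heq | hgt
  · refine Commute.symm ?_
    rw [zconj_commute_iff, zero_sub]
    -- Any m with mp above the difference serves; the difference plus one does, as p ≥ 1.
    refine main (-(j - i)).toNat.succ _ (by omega) ?_ (by rwa [dvd_neg])
    have : (-(j - i)).toNat.succ * 1 ≤ (-(j - i)).toNat.succ * p := Nat.mul_le_mul_left _ hp
    have : ((-(j - i)).toNat.succ : ℤ) * 1 ≤ (-(j - i)).toNat.succ * p := by exact_mod_cast this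
    omega
  · rw [heq] at hij; simp at hij
  · refine main (j - i).toNat.succ _ (by omega) ?_ hij
    have : (j - i).toNat.succ * 1 ≤ (j - i).toNat.succ * p := Nat.mul_le_mul_left _ hp
    have : ((j - i).toNat.succ : ℤ) * 1 ≤ (j - i).toNat.succ * p := by exact_mod_cast this
    omega

end Commutation

/-! ### The normal closure of the relators -/

/-- The presented group is the quotient of the free group by the normal closure of the relators. -/
abbrev Pres (p : ℕ) : Type := PresentedGroup (relators p)

theorem mk_relator (p k : ℕ) {m l : ℕ} (hl : 1 ≤ l) (hlp : l < p) :
    PresentedGroup.mk (relators p)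
      ((xi p ^ k) ((theta p ^ m) (comm fa (conj fa (fb ^ l))))) = 1 :=
  PresentedGroup.one_of_mem ⟨k, m, l, hl, hlp, rfl⟩

theorem mk_theta_pow_fa (p m : ℕ) : PresentedGroup.mk (relators p) ((theta p ^ m) fa) =
    thetaSeq p (PresentedGroup.mk (relators p) fa) (PresentedGroup.mk (relators p) fb) m := by
  induction m with
  | zero => rfl
  | succ m ih =>
    rw [theta_pow_succ_fa, thetaSeq, ← ih]
    simp only [conj, map_mul, map_inv, map_pow]

theorem commute_of_comm_eq_one {H : Type*} [Group H] {x y : H} (h : comm x y = 1) :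
    Commute x y := by
  rw [comm, mul_assoc, ← mul_inv_rev, inv_mul_eq_one] at h
  exact h.symm

theorem mk_zconj_commute {p : ℕ} (hp : 0 < p) {i j : ℤ} (hij : ¬ (p : ℤ) ∣ j - i) :
    Commute (PresentedGroup.mk (relators p) (zconj fa fb i))
      (PresentedGroup.mk (relators p) (zconj fa fb j)) := by
  have key : ∀ i, PresentedGroup.mk (relators p) (zconj fa fb i) =
      zconj (PresentedGroup.mk (relators p) fa) (PresentedGroup.mk (relators p) fb) i := by
    intro i; simp only [zconj, conj, map_mul, map_inv, map_zpow]
  rw [key, key]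
  refine zconj_commute hp (fun m l hl hlp => ?_) hij
  have h := mk_relator p 0 (m := m) hl hlp
  rw [pow_zero] at h
  change PresentedGroup.mk (relators p) ((theta p ^ m) (comm fa (conj fa (fb ^ l)))) = 1 at h
  rw [theta_pow_relator] at h
  rw [← mk_theta_pow_fa]
  apply commute_of_comm_eq_one
  simpa only [comm, conj, map_mul, map_inv, map_pow] using h

theorem toAut_eq_one_of_mem_normalClosure {w : F}
    (hw : w ∈ Subgroup.normalClosure (relators p)) : toAut p w = 1 :=
  Subgroup.normalClosure_le_normal (N := (toAut p).ker) (fun _ hr => toAut_relator hr) hw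

theorem killB_eq_one_of_mem_normalClosure {w : F}
    (hw : w ∈ Subgroup.normalClosure (relators p)) : killB w = 1 :=
  Subgroup.normalClosure_le_normal (N := killB.ker) (fun _ hr => killB_relator hr) hw

theorem xi_mem_normalClosure {w : F} (hw : w ∈ Subgroup.normalClosure (relators p)) :
    xi p w ∈ Subgroup.normalClosure (relators p) := by
  have h : Subgroup.normalClosure (relators p) ≤
      (Subgroup.normalClosure (relators p)).comap (xi p : F →* F) := by
    have := (Subgroup.normalClosure_normal (s := relators p)).comap (xi p : F →* F)
    refine Subgroup.normalClosure_le_normal ?_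
    rintro _ ⟨k, m, l, hl, hlp, rfl⟩
    exact Subgroup.subset_normalClosure ⟨k + 1, m, l, hl, hlp, (End_pow_succ_apply' _ _ _).symm⟩
  exact h hw

/-! ### Lifting sections from the first level -/

/-- The homomorphism with image the normal closure of `b`, with `n ↦ b^{a^n}`. -/
def bConj : FreeGroup ℤ →* F := FreeGroup.lift fun n => zconj fb fa n

theorem killB_bConj (u : FreeGroup ℤ) : killB (bConj u) = 1 := by
  change (killB.comp bConj) u = (1 : FreeGroup ℤ →* F) u
  congr 1
  ext n
  simp [bConj, zconj, conj]

/-- The embedding of the normal closure of `b` at the vertex `p - 1 - k` of the first level. -/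
def embed (p k : ℕ) : FreeGroup ℤ →* F :=
  (MulAut.conj (fb ^ k)).toMonoidHom.comp ((xi p : F →* F).comp bConj)

theorem embed_apply (p k : ℕ) (u : FreeGroup ℤ) :
    embed p k u = fb ^ k * xi p (bConj u) * (fb ^ k)⁻¹ := rfl

theorem root_embed (k : ℕ) (u : FreeGroup ℤ) : root p (embed p k u) = 1 := by
  rw [embed_apply]
  simp [root_mul, root_inv, root_xi, ← Perm.inv_def]

theorem sec_embed {k : ℕ} (hk : k < p) (u : FreeGroup ℤ) (x : Fin p) :
    sec p (embed p k u) x = if (x : ℕ) + 1 + k = p then bConj u else 1 := by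
  have hx := x.2
  rw [embed_apply, sec_mul, sec_mul, root_mul, root_xi, sec_inv, one_mul,
    Equiv.symm_apply_apply, sec_fb_pow hk.le, sec_xi, root_pow, root_fb, finRotate_pow_val,
    killB_bConj]
  by_cases h : p ≤ x + k
  · have e : ((x : ℕ) + k) % p = x + k - p := by
      rw [Nat.mod_eq_sub_mod h, Nat.mod_eq_of_lt (by omega)]
    rw [e, if_pos h, if_neg (by omega), if_neg (by omega)]; simp
  · rw [Nat.mod_eq_of_lt (by omega), if_neg h]
    by_cases h' : (x : ℕ) + 1 + k = p
    · rw [if_pos (by omega), if_pos h']; simp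
    · rw [if_neg (by omega), if_neg h']; simp

theorem embed_of (p k : ℕ) (n : ℤ) :
    embed p k (FreeGroup.of n) = zconj fa fb (n * p - k) := by
  have h : xi p (bConj (FreeGroup.of n)) = conj fa ((fb ^ p) ^ n) := by
    simp only [bConj, FreeGroup.lift_apply_of, zconj, conj, map_mul, map_inv, map_zpow, xi_fa,
      xi_fb]
  rw [embed_apply, h, zconj, conj, conj, ← zpow_natCast fb p, ← zpow_natCast fb k, ← zpow_mul,
    sub_eq_add_neg, zpow_add, zpow_neg, mul_comm n]
  group

/-- The free group on the conjugates of `a` by powers of `b`, which are indexed by the vertices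
of the first level and the integers, mapped to the free group on `{a, b}`. -/
def conjHom (p : ℕ) : FreeGroup (Fin p × ℤ) →* F :=
  FreeGroup.lift fun i => embed p i.1 (FreeGroup.of i.2)

/-- The coordinates of an element of the normal closure of `a`. -/
def coord (k : Fin p) : FreeGroup (Fin p × ℤ) →* FreeGroup ℤ :=
  FreeGroup.lift fun i => if i.1 = k then FreeGroup.of i.2 else 1

/-- The reversal `k.rev` appears because `embed p k` is supported at the vertex p - 1 - k. -/
theorem root_sec_conjHom (u : FreeGroup (Fin p × ℤ)) : root p (conjHom p u) = 1 ∧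
    ∀ k : Fin p, sec p (conjHom p u) k.rev = bConj (coord k u) := by
  induction u using FreeGroup.induction_on with
  | C1 => simp
  | of i =>
    simp only [conjHom, FreeGroup.lift_apply_of, coord]
    refine ⟨root_embed _ _, fun k => ?_⟩
    rw [sec_embed i.1.2, Fin.val_rev]
    by_cases h : i.1 = k
    · subst h
      have := i.1.2
      rw [if_pos (by omega), if_pos rfl]
    · have := i.1.2
      have := k.2
      have h' : (i.1 : ℕ) ≠ k := fun e => h (Fin.ext e)
      rw [if_neg (by omega), if_neg h, map_one]
  | inv_of i h =>
    rw [map_inv]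
    refine ⟨by rw [root_inv, h.1]; rfl, fun k => ?_⟩
    rw [sec_inv, h.1, map_inv, map_inv, ← h.2]; rfl
  | mul u v h h' =>
    rw [map_mul]
    refine ⟨by rw [root_mul, h.1, h'.1]; rfl, fun k => ?_⟩
    rw [sec_mul, h.1, h.2, map_mul, map_mul, ← h'.2]; rfl

theorem zconj_mem_range (hp : 0 < p) (j : ℤ) : zconj fa fb j ∈ (conjHom p).range := by
  have h1 := Int.emod_nonneg (-j) (b := p) (by omega)
  have h2 := Int.emod_lt_of_pos (-j) (b := p) (by omega)
  -- Division with remainder of -j by p writes j as np - k with 0 ≤ k < p.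
  refine ⟨FreeGroup.of (⟨((-j) % p).toNat, by omega⟩, -((-j) / p)), ?_⟩
  simp only [conjHom, FreeGroup.lift_apply_of, embed_of]
  congr 1
  rw [Int.toNat_of_nonneg h1]
  have := Int.emod_add_mul_ediv (-j) p
  linarith

theorem conj_mem_range (hp : 0 < p) {g : F} (hg : g ∈ (conjHom p).range) (s : ℤ) :
    conj g (fb ^ s) ∈ (conjHom p).range := by
  obtain ⟨u, rfl⟩ := hg
  induction u using FreeGroup.induction_on with
  | C1 => simp [conj]
  | of i =>
    have e : conjHom p (FreeGroup.of i) = zconj fa fb (i.2 * p - (i.1 : ℕ)) := by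
      simp only [conjHom, FreeGroup.lift_apply_of, embed_of]
    rw [e, conj_zconj]
    exact zconj_mem_range hp _
  | inv_of i h =>
    have e : ∀ g h : F, conj g⁻¹ h = (conj g h)⁻¹ := by intro g h; simp only [conj]; group
    rw [map_inv, e]
    exact inv_mem h
  | mul u v h h' => rw [map_mul, conj_mul]; exact mul_mem h h'

/-- F is the semidirect product of the normal closure of a with ⟨b⟩; the range of `conjHom` contains
a and is stable under conjugation by powers of b. -/
theorem exists_eq_conjHom_mul_zpow (hp : 0 < p) (w : F) :
    ∃ u, ∃ s : ℤ, w = conjHom p u * fb ^ s := by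
  induction w using free_induction with
  | one => exact ⟨1, 0, by simp⟩
  | of_a =>
    obtain ⟨u, hu⟩ := zconj_mem_range hp 0
    exact ⟨u, 0, by rw [hu]; simp [zconj, conj]⟩
  | of_b => exact ⟨1, 1, by simp⟩
  | inv w h =>
    obtain ⟨u, s, rfl⟩ := h
    obtain ⟨v, hv⟩ := conj_mem_range hp ⟨u⁻¹, rfl⟩ s
    refine ⟨v, -s, ?_⟩
    rw [hv, conj, map_inv]
    group
  | mul w w' h h' =>
    obtain ⟨u, s, rfl⟩ := h
    obtain ⟨u', s', rfl⟩ := h'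
    obtain ⟨v, hv⟩ := conj_mem_range hp ⟨u', rfl⟩ (-s)
    refine ⟨u * v, s + s', ?_⟩
    rw [map_mul, hv, conj, zpow_add]
    group

theorem mk_embed_commute (hp : 0 < p) {k k' : Fin p} (hk : k ≠ k') (u v : FreeGroup ℤ) :
    Commute (PresentedGroup.mk (relators p) (embed p k u))
      (PresentedGroup.mk (relators p) (embed p k' v)) := by
  have hdvd : ∀ n n' : ℤ, ¬ (p : ℤ) ∣ (n' * p - (k' : ℕ)) - (n * p - (k : ℕ)) := by
    intro n n' h
    have e : (n' * p - (k' : ℕ)) - (n * p - (k : ℕ)) = (n' - n) * (p : ℤ) + ((k : ℕ) - (k' : ℕ)) := by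
      ring
    rw [e, Int.dvd_add_right (Dvd.intro_left _ rfl)] at h
    have h1 := k.2
    have h2 := k'.2
    have := Int.eq_zero_of_abs_lt_dvd h (by rw [abs_lt]; constructor <;> omega)
    exact hk (Fin.ext (by omega))
  induction u using FreeGroup.induction_on with
  | C1 => simp
  | of n =>
    induction v using FreeGroup.induction_on with
    | C1 => simp
    | of n' =>
      rw [embed_of, embed_of]
      exact mk_zconj_commute hp (hdvd n n')
    | inv_of n' h => rw [map_inv, map_inv]; exact h.inv_right
    | mul v v' h h' => rw [map_mul, map_mul]; exact h.mul_right h'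
  | inv_of n h => rw [map_inv, map_inv]; exact h.inv_left
  | mul v v' h h' => rw [map_mul, map_mul]; exact h.mul_left h'

/-- Modulo N the p factors commute, so u may be sorted into its coordinates; each sorted factor is a
conjugate of ξ of an element of N. -/
theorem conjHom_mem_normalClosure (hp : 0 < p) (u : FreeGroup (Fin p × ℤ))
    (h : ∀ k : Fin p, bConj (coord k u) ∈ Subgroup.normalClosure (relators p)) :
    conjHom p u ∈ Subgroup.normalClosure (relators p) := by
  let ϕ : ∀ _ : Fin p, FreeGroup ℤ →* Pres p := fun k =>
    (PresentedGroup.mk (relators p)).comp (embed p k)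
  have hcomm : Pairwise fun k k' => ∀ x y, Commute (ϕ k x) (ϕ k' y) :=
    fun k k' hk x y => mk_embed_commute hp hk x y
  have key : (PresentedGroup.mk (relators p)).comp (conjHom p) =
      (MonoidHom.noncommPiCoprod ϕ hcomm).comp (MonoidHom.pi fun k => coord k) := by
    ext i
    rw [MonoidHom.comp_apply, MonoidHom.comp_apply]
    have e : (MonoidHom.pi fun k => coord k) (FreeGroup.of i) =
        Pi.mulSingle (M := fun _ : Fin p => FreeGroup ℤ) i.1 (FreeGroup.of i.2) := by
      ext1 k
      simp only [MonoidHom.pi_apply, coord, FreeGroup.lift_apply_of, Pi.mulSingle_apply,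
        eq_comm (a := i.1)]
    rw [e, MonoidHom.noncommPiCoprod_mulSingle]
    simp only [conjHom, FreeGroup.lift_apply_of]
    rfl
  rw [← PresentedGroup.mk_eq_one_iff]
  change ((PresentedGroup.mk (relators p)).comp (conjHom p)) u = 1
  rw [key, MonoidHom.comp_apply, MonoidHom.noncommPiCoprod_apply]
  refine (Finset.noncommProd_eq_pow_card _ _ _ 1 fun k _ => ?_).trans (one_pow _)
  change PresentedGroup.mk (relators p) (embed p k (coord k u)) = 1
  rw [PresentedGroup.mk_eq_one_iff, embed_apply]
  exact Subgroup.normalClosure_normal.conj_mem _ (xi_mem_normalClosure (h k)) _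

theorem sec_zpow_of_root_eq_one {w : F} (hw : root p w = 1) (n : ℤ) (x : Fin p) :
    root p (w ^ n) = 1 ∧ sec p (w ^ n) x = sec p w x ^ n := by
  induction n using Int.induction_on with
  | zero => simp
  | succ n ih =>
    rw [zpow_add_one, root_mul, sec_mul, ih.1, ih.2, hw, zpow_add_one]
    exact ⟨rfl, rfl⟩
  | pred n ih =>
    rw [zpow_sub_one, root_mul, sec_mul, ih.1, ih.2, root_inv, sec_inv, hw, zpow_sub_one]
    exact ⟨rfl, rfl⟩

theorem dvd_of_root_fb_zpow (hp : 0 < p) {s : ℤ} (hs : root p (fb ^ s) = 1) : (p : ℤ) ∣ s := by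
  have nat : ∀ n : ℕ, root p (fb ^ n) = 1 → p ∣ n := by
    intro n hn
    have := finRotate_pow_val n (⟨0, hp⟩ : Fin p)
    rw [← root_fb, ← root_pow, hn] at this
    simp only [Perm.one_apply, zero_add] at this
    exact Nat.dvd_of_mod_eq_zero this.symm
  rcases Int.natAbs_eq s with h | h
  · rw [h, zpow_natCast] at hs
    rw [h]; exact Int.natCast_dvd_natCast.2 (nat _ hs)
  · rw [h, zpow_neg, root_inv, zpow_natCast] at hs
    rw [h, dvd_neg]
    refine Int.natCast_dvd_natCast.2 (nat _ ?_)
    have := congrArg Equiv.symm hs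
    rwa [Equiv.symm_symm] at this

/-- Write w as an element of the normal closure of a times b^s. Triviality at the root gives s = pt,
so each section is an element of the normal closure of b times a^t. -/
theorem mem_normalClosure_of_sec (hp : 0 < p) {w : F} (hw : root p w = 1)
    (hs : ∀ x, sec p w x ∈ Subgroup.normalClosure (relators p)) :
    w ∈ Subgroup.normalClosure (relators p) := by
  obtain ⟨u, s, rfl⟩ := exists_eq_conjHom_mul_zpow hp w
  have hu := root_sec_conjHom u
  rw [root_mul, hu.1, mul_one] at hw
  obtain ⟨t, rfl⟩ := dvd_of_root_fb_zpow hp hw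
  have hsec : ∀ k : Fin p, bConj (coord k u) * fa ^ t ∈ Subgroup.normalClosure (relators p) := by
    intro k
    have := hs k.rev
    rwa [sec_mul, hu.1, hu.2, zpow_mul, zpow_natCast,
      (sec_zpow_of_root_eq_one root_fb_pow_self t _).2, sec_fb_pow_self] at this
  -- Killing b annihilates N and the first factor, leaving a^t = 1 in the free group.
  have ht : t = 0 := by
    have := killB_eq_one_of_mem_normalClosure (hsec ⟨0, hp⟩)
    rw [map_mul, killB_bConj, one_mul, map_zpow, killB_fa] at this
    by_contra hne
    exact FreeGroup.of_ne_one _ ((IsMulTorsionFree.zpow_eq_one_iff_left hne).1 this)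
  subst ht
  simp only [zpow_zero, mul_one, mul_zero] at hsec ⊢
  exact conjHom_mem_normalClosure hp u hsec

/-! ### Contraction of word length -/

theorem finRotate_val_of_last (hp : 2 ≤ p) {x : Fin p} (hx : (x : ℕ) + 1 = p) :
    (finRotate p x : ℕ) + 1 ≠ p := by
  have := finRotate_pow_val 1 x
  rw [pow_one, hx, Nat.mod_self] at this
  omega

/-- Sections do not increase the length of a word, and a section of full length forces the shape
`b^{-d} a^i b^e`. -/
theorem exists_section_word (hp : 2 ≤ p) (L : List (Gen × Bool)) (x : Fin p) :
    ∃ M : List (Gen × Bool), FreeGroup.mk M = sec p (FreeGroup.mk L) x ∧ M.length ≤ L.length ∧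
      (M.length = L.length → ∃ i : ℤ, ∃ e : ℕ, e ≤ 1 ∧
        FreeGroup.mk L = (fb ^ (if (x : ℕ) + 1 = p then 0 else 1))⁻¹ * (fa ^ i * fb ^ e)) := by
  induction L generalizing x with
  | nil =>
    refine ⟨[], sec_one x |>.symm, le_rfl, fun _ => ?_⟩
    -- The empty word has full length at every vertex, so e is chosen to cancel the prefix b^{-d}.
    refine ⟨0, if (x : ℕ) + 1 = p then 0 else 1, by split_ifs <;> simp, ?_⟩
    rw [zpow_zero, one_mul, inv_mul_cancel]; rfl
  | cons g L ih =>
    have cons_mk : ∀ (g : Gen × Bool) (L : List (Gen × Bool)),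
        FreeGroup.mk (g :: L) = FreeGroup.mk [g] * FreeGroup.mk L := fun g L => by
      rw [FreeGroup.mul_mk]; rfl
    obtain ⟨g, s⟩ := g
    rw [cons_mk, sec_mul]
    obtain ⟨M, hM, hlen, heq⟩ := ih (root p (FreeGroup.mk [(g, s)]) x)
    rw [← hM]
    -- A first letter with trivial section makes the length drop, so the clause on full length is
    -- vacuous.
    have triv : sec p (FreeGroup.mk [(g, s)]) x = 1 → _ := fun h1 =>
      (⟨M, by rw [h1, one_mul], by simp; omega, fun h => by simp at h; omega⟩ :
        ∃ M' : List (Gen × Bool), FreeGroup.mk M' =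
          sec p (FreeGroup.mk [(g, s)]) x * FreeGroup.mk M ∧ M'.length ≤ ((g, s) :: L).length ∧
          (M'.length = ((g, s) :: L).length → ∃ i : ℤ, ∃ e : ℕ, e ≤ 1 ∧
            FreeGroup.mk [(g, s)] * FreeGroup.mk L =
              (fb ^ (if (x : ℕ) + 1 = p then 0 else 1))⁻¹ * (fa ^ i * fb ^ e)))
    have step : ∀ h : Gen × Bool, sec p (FreeGroup.mk [(g, s)]) x = FreeGroup.mk [h] →
        FreeGroup.mk (h :: M) = sec p (FreeGroup.mk [(g, s)]) x * FreeGroup.mk M := fun h h1 => by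
      rw [h1, cons_mk]
    have ea : FreeGroup.mk [(Gen.a, true)] = fa := rfl
    have eb : FreeGroup.mk [(Gen.b, true)] = fb := rfl
    have ea' : FreeGroup.mk [(Gen.a, false)] = fa⁻¹ := rfl
    have eb' : FreeGroup.mk [(Gen.b, false)] = fb⁻¹ := rfl
    rcases g with _ | _ <;> rcases s with _ | _
    · by_cases hx : (x : ℕ) + 1 = p
      · refine ⟨(Gen.b, false) :: M, step _ ?_, by simpa using hlen, fun h => ?_⟩
        · rw [ea', eb', sec_inv, root_fa, perm_one_symm, Perm.one_apply, sec_fa, if_pos hx]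
        · obtain ⟨i, e, he, hL⟩ := heq (by simpa using h)
          refine ⟨i - 1, e, he, ?_⟩
          rw [ea', root_inv, root_fa, perm_one_symm, Perm.one_apply, if_pos hx] at hL
          rw [hL, ea', if_pos hx]
          group
      · apply triv
        rw [ea', sec_inv, root_fa, perm_one_symm, Perm.one_apply, sec_fa, if_neg hx, inv_one]
    · by_cases hx : (x : ℕ) + 1 = p
      · refine ⟨(Gen.b, true) :: M, step _ ?_, by simpa using hlen, fun h => ?_⟩
        · rw [ea, eb, sec_fa, if_pos hx]
        · obtain ⟨i, e, he, hL⟩ := heq (by simpa using h)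
          refine ⟨i + 1, e, he, ?_⟩
          rw [ea, root_fa, Perm.one_apply, if_pos hx] at hL
          rw [hL, ea, if_pos hx]
          group
      · apply triv
        rw [ea, sec_fa, if_neg hx]
    · by_cases hx : ((root p fb).symm x : ℕ) + 1 = p
      · have hx' : (x : ℕ) + 1 ≠ p := by
          have := finRotate_val_of_last hp hx
          rwa [← root_fb, Equiv.apply_symm_apply] at this
        refine ⟨(Gen.a, false) :: M, step _ ?_, by simpa using hlen, fun h => ?_⟩
        · rw [ea', eb', sec_inv, sec_fb, if_pos hx]
        · obtain ⟨i, e, he, hL⟩ := heq (by simpa using h)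
          refine ⟨i, e, he, ?_⟩
          rw [eb', root_inv, if_pos hx] at hL
          rw [hL, eb', if_neg hx']
          group
      · apply triv
        rw [eb', sec_inv, sec_fb, if_neg hx, inv_one]
    · by_cases hx : (x : ℕ) + 1 = p
      · refine ⟨(Gen.a, true) :: M, step _ ?_, by simpa using hlen, fun h => ?_⟩
        · rw [ea, eb, sec_fb, if_pos hx]
        · obtain ⟨i, e, he, hL⟩ := heq (by simpa using h)
          refine ⟨i, e, he, ?_⟩
          -- After b the path has left the last vertex, so the rest of the word equals b^{-1} a^i
          -- b^e and its b^{-1} cancels this b.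
          rw [eb, root_fb, if_neg (finRotate_val_of_last hp hx)] at hL
          rw [hL, eb, if_pos hx]
          group
      · apply triv
        rw [eb, sec_fb, if_neg hx]

theorem sec_toAut {w : F} (h : toAut p w = 1) (x : Fin p) : toAut p (sec p w x) = 1 :=
  ((toAut_eq_one_iff w).1 h).2 x

/-- Descent: the section of a^i at the last vertex is b^i, which forces i = pj, and b^{pj} has
section a^j. -/
theorem eq_zero_of_toAut_fa_zpow (hp : 2 ≤ p) (i : ℤ) (h : toAut p (fa ^ i) = 1) : i = 0 := by
  induction hn : i.natAbs using Nat.strong_induction_on generalizing i with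
  | _ n ih =>
    have hlast : ((⟨p - 1, by omega⟩ : Fin p) : ℕ) + 1 = p := by simp; omega
    have hb := sec_toAut h ⟨p - 1, by omega⟩
    rw [(sec_zpow_of_root_eq_one root_fa i _).2, sec_fa, if_pos hlast] at hb
    obtain ⟨j, rfl⟩ := dvd_of_root_fb_zpow (by omega) ((toAut_eq_one_iff _).1 hb).1
    have ha := sec_toAut hb ⟨p - 1, by omega⟩
    rw [zpow_mul, zpow_natCast, (sec_zpow_of_root_eq_one root_fb_pow_self j _).2,
      sec_fb_pow_self] at ha
    by_contra hne
    have hj : j ≠ 0 := by rintro rfl; simp at hne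
    rw [Int.natAbs_mul, Int.natAbs_natCast] at hn
    have : 2 * j.natAbs ≤ p * j.natAbs := Nat.mul_le_mul_right _ hp
    exact hj (ih j.natAbs (by omega) j ha rfl)

/-- The root permutation is rotation by e - d, and |e - d| ≤ 1 < p forces e = d; what remains is a
conjugate of a^i. -/
theorem eq_one_of_toAut_eq_one (hp : 2 ≤ p) {i : ℤ} {d e : ℕ} (hd : d ≤ 1) (he : e ≤ 1)
    (h : toAut p ((fb ^ d)⁻¹ * (fa ^ i * fb ^ e)) = 1) : (fb ^ d)⁻¹ * (fa ^ i * fb ^ e) = 1 := by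
  have hr := ((toAut_eq_one_iff _).1 h).1
  have ha := (sec_zpow_of_root_eq_one (p := p) root_fa i ⟨0, by omega⟩).1
  have hdvd : (p : ℤ) ∣ e - d := by
    apply dvd_of_root_fb_zpow (by omega)
    rw [zpow_sub, zpow_natCast, zpow_natCast]
    rw [root_mul, root_mul, ha, mul_one] at hr
    rw [root_mul]
    exact mul_eq_one_comm.1 hr
  have := Int.eq_zero_of_abs_lt_dvd hdvd (by rw [abs_lt]; constructor <;> omega)
  obtain rfl : e = d := by omega
  have h0 : toAut p (fa ^ i) = 1 := by
    rw [map_mul, map_mul, map_inv] at h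
    rwa [inv_mul_eq_one, right_eq_mul] at h
  rw [eq_zero_of_toAut_fa_zpow hp i h0]
  simp

theorem mk_mem_normalClosure (hp : 2 ≤ p) (L : List (Gen × Bool))
    (h : toAut p (FreeGroup.mk L) = 1) :
    FreeGroup.mk L ∈ Subgroup.normalClosure (relators p) := by
  induction hn : L.length using Nat.strong_induction_on generalizing L with
  | _ n ih =>
    by_cases hfull : ∃ x : Fin p, ∃ i : ℤ, ∃ e : ℕ, e ≤ 1 ∧
        FreeGroup.mk L = (fb ^ (if (x : ℕ) + 1 = p then 0 else 1))⁻¹ * (fa ^ i * fb ^ e)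
    · obtain ⟨x, i, e, he, hL⟩ := hfull
      rw [hL] at h ⊢
      rw [eq_one_of_toAut_eq_one hp (by split_ifs <;> simp) he h]
      exact one_mem _
    · refine mem_normalClosure_of_sec (by omega) ((toAut_eq_one_iff _).1 h).1 fun x => ?_
      obtain ⟨M, hM, hlen, heq⟩ := exists_section_word hp L x
      have hlt : M.length < n := by
        rw [← hn]
        exact lt_of_le_of_ne hlen fun hl => hfull ⟨x, heq hl⟩
      have := sec_toAut h x
      rw [← hM] at this ⊢
      exact ih _ hlt M this rfl

theorem toAut_eq_one_iff_mem_normalClosure (hp : 2 ≤ p) (w : F) :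
    toAut p w = 1 ↔ w ∈ Subgroup.normalClosure (relators p) := by
  refine ⟨fun h => ?_, toAut_eq_one_of_mem_normalClosure⟩
  obtain ⟨L, rfl⟩ := Quot.exists_rep w
  exact mk_mem_normalClosure hp _ h

/-! ### The image and the form of the presentation -/

theorem range_toAut : (toAut p).range = group p := by
  rw [toAut, FreeGroup.range_lift_eq_closure, group]
  congr 1
  ext x
  constructor
  · rintro ⟨g, rfl⟩
    cases g <;> simp
  · rintro (rfl | rfl)
    exacts [⟨.a, rfl⟩, ⟨.b, rfl⟩]

theorem relators_eq_lRelators (p : ℕ) : relators p = lRelators ∅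
    {r | ∃ m l : ℕ, 1 ≤ l ∧ l < p ∧ r = (theta p ^ m) (comm fa (conj fa (fb ^ l)))} {xi p} := by
  ext r
  simp only [relators, lRelators, Set.empty_union, Set.mem_iUnion, Set.mem_image, Set.mem_ofPred_eq,
    Submonoid.mem_closure_singleton]
  constructor
  · rintro ⟨k, m, l, hl, hlp, rfl⟩
    exact ⟨_, ⟨k, rfl⟩, _, ⟨m, l, hl, hlp, rfl⟩, rfl⟩
  · rintro ⟨_, ⟨k, rfl⟩, _, ⟨m, l, hl, hlp, rfl⟩, rfl⟩
    exact ⟨k, m, l, hl, hlp, rfl⟩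

end Basilica

theorem mainTheorem12 (p : ℕ) (hp : p.Prime) :
    (∃ e : PresentedGroup (Basilica.relators p) ≃* Basilica.group p,
      (e (PresentedGroup.of Basilica.Gen.a) : Basilica.AutT p) = Basilica.gen p .a ∧
      (e (PresentedGroup.of Basilica.Gen.b) : Basilica.AutT p) = Basilica.gen p .b) ∧
    Basilica.relators p =
      Basilica.lRelators ∅
        {r | ∃ m l : ℕ, 1 ≤ l ∧ l < p ∧
          r = (Basilica.theta p ^ m)
            (Basilica.comm Basilica.fa (Basilica.conj Basilica.fa (Basilica.fb ^ l)))}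
        {Basilica.xi p} := by
  refine ⟨?_, Basilica.relators_eq_lRelators p⟩
  have hker : Subgroup.normalClosure (Basilica.relators p) = (Basilica.toAut p).ker := by
    ext w
    rw [← Basilica.toAut_eq_one_iff_mem_normalClosure hp.two_le, MonoidHom.mem_ker]
  exact ⟨(QuotientGroup.quotientMulEquivOfEq hker).trans
    ((QuotientGroup.quotientKerEquivRange _).trans
      (MulEquiv.subgroupCongr Basilica.range_toAut)),
    FreeGroup.lift_apply_of, FreeGroup.lift_apply_of⟩
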